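/- Let $m\ge 1$ be an integer. For a field $F$ and the row space $W=F^{n}$, let $F(mW)=F(x_{ij}\mid 1\le i\le m,\ 1\le j\le n)$ be the field of rational functions on $mW=W\oplus\cdots\oplus W$ ($m$ copies), where $x_{ij}$ is the $j$-th coordinate function on the $i$-th copy. Put $X_i={}^t(x_{i1},\dots,x_{in})$ and $X_i^{e}={}^t(x_{i1}^{e},\dots,x_{in}^{e})$. A matrix $T\in \mathrm{GL}_n(F)$ acts on $F(mW)$ by the $F$-automorphism $x_{ij}\mapsto\sum_{l}T_{lj}x_{il}$, i.e. $X_i\mapsto {}^tT\,X_i$ for every $i$; for a subgroup $G\le \mathrm{GL}_n(F)$ let $F(mW)^G$ be the subfield of elements fixed by all of $G$. (1) Let $\mathbb F_q$ be a finite field, and let $K$ be a nonsingular $2n\times 2n$ alternate matrix over $\mathbb F_q$ (that is, ${}^tK=-K$ with zero diagonal). Let $Sp_{2n}(\mathbb F_q,K)=\{T\in \mathrm{GL}_{2n}(\mathbb F_q)\mid TK\,{}^tT=K\}$, let $W=\mathbb F_q^{2n}$, and let $Q_{ij}^{(k)}={}^tX_i\,K\,X_j^{q^k}$. Then $$\mathbb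 F_q(mW)^{Sp_{2n}(\mathbb F_q,K)}=\mathbb F_q\bigl(Q_{i1}^{(k)}\mid 1\le i\le m,\ 1\le k\le 2n\bigr).$$ (2) Let $\mathbb F_{q}$ be a finite field of odd characteristic, and let $\mathbb F_{q^2}$ be its quadratic extension, with involution $\overline a=a^q$ (applied entrywise to matrices). Let $H$ be a nonsingular $n\times n$ Hermitian matrix over $\mathbb F_{q^2}$ (that is, ${}^t\overline H=H$). Let $U(\mathbb F_{q^2},H)=\{T\in \mathrm{GL}_n(\mathbb F_{q^2})\mid TH\,{}^t\overline T=H\}$, let $W=\mathbb F_{q^2}^{\,n}$, and let $H_{ij}^{(k)}={}^tX_i\,H\,X_j^{q^{2k+1}}$. Then $$\mathbb F_{q^2}(mW)^{U(\mathbb F_{q^2},H)}=\mathbb F_{q^2}\bigl(H_{i1}^{(k)}\mid 1\le i\le m,\ 0\le k\le n-1\bigr).$$ (3) Let $\mathbb F_q$ be a finite field of odd characteristic, and let $A$ be a nonsingular symmetric $n\times n$ matrix over $\mathbb F_q$. Let $O_n(\mathbb F_q,A)=\{T\in \mathrm{GL}_n(\mathbb F_q)\mid TA\,{}^tT=A\}$,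 let $W=\mathbb F_q^{\,n}$, and let $P_{ij}^{(k)}={}^tX_i\,A\,X_j^{q^k}$. Then $$\mathbb F_q(mW)^{O_n(\mathbb F_q,A)}=\mathbb F_q\bigl(P_{i1}^{(k)}\mid 1\le i\le m,\ 0\le k\le n-1\bigr).$$ -/

import Mathlib

namespace VectorInvariants

open Matrix MvPolynomial

/-- The coordinate ring `F[mW]`, for `W` the `n`-dimensional space `F ^ n`. The variable `X (i, j)`
is the `j`-th coordinate function `x_{ij}` on the `i`-th copy of `W`. -/
abbrev CoordRing (F : Type*) [Field F] (m n : ℕ) : Type _ :=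
  MvPolynomial (Fin m × Fin n) F

/-- The field `F(mW)` of rational functions on `mW`. -/
abbrev RatField (F : Type*) [Field F] (m n : ℕ) : Type _ :=
  FractionRing (CoordRing F m n)

section Action

variable {F : Type*} [Field F] {n : ℕ}

/-- The substitution `x_{ij} ↦ ∑ l, T_{lj} x_{il}`, that is `X_i ↦ ᵗT X_i` for the column vectors
`X_i = ᵗ(x_{i1}, …, x_{in})`. -/
noncomputable def subst (m : ℕ) (T : Matrix (Fin n) (Fin n) F) :
    CoordRing F m n →ₐ[F] CoordRing F m n :=
  aeval fun p => ∑ l, C (T l p.2) * X (p.1, l)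

theorem subst_mul (m : ℕ) (S T : Matrix (Fin n) (Fin n) F) :
    subst m (S * T) = (subst m S).comp (subst m T) := by
  refine MvPolynomial.algHom_ext fun p => ?_
  simp only [subst, AlgHom.comp_apply, aeval_X, map_sum, map_mul, algHom_C,
    MvPolynomial.algebraMap_eq, Matrix.mul_apply, Finset.sum_mul, Finset.mul_sum]
  rw [Finset.sum_comm]
  refine Finset.sum_congr rfl fun l _ => Finset.sum_congr rfl fun k _ => ?_
  ring

theorem subst_one (m : ℕ) :
    subst m (1 : Matrix (Fin n) (Fin n) F) = AlgHom.id F (CoordRing F m n) := by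
  refine MvPolynomial.algHom_ext fun p => ?_
  simp [subst, Matrix.one_apply]

/-- The diagonal action of `GL_n(F)` on `F[mW]` by algebra automorphisms: `GL_n(F)` acts on the
row space `W = F ^ n` by `w ↦ w T`, and on functions by `(T f)(w_1, …, w_m) = f(w_1 T, …, w_m T)`. -/
noncomputable def ringAction (F : Type*) [Field F] (m n : ℕ) :
    GL (Fin n) F →* (CoordRing F m n ≃ₐ[F] CoordRing F m n) where
  toFun T := AlgEquiv.ofAlgHom (subst m T.val) (subst m T.inv)
    (by rw [← subst_mul, T.val_inv, subst_one]) (by rw [← subst_mul, T.inv_val, subst_one])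
  map_one' := by
    ext1 f
    exact DFunLike.congr_fun (subst_one m) f
  map_mul' S T := by
    ext1 f
    exact DFunLike.congr_fun (subst_mul m S.val T.val) f

/-- The induced action of `GL_n(F)` on the field `F(mW)`. -/
noncomputable def fieldAction (F : Type*) [Field F] (m n : ℕ) :
    GL (Fin n) F →* (RatField F m n ≃ₐ[F] RatField F m n) :=
  (IsFractionRing.fieldEquivOfAlgEquivHom F (RatField F m n)).comp (ringAction F m n)

/-- The invariant field `F(mW)^G` of a subgroup `G` of `GL_n(F)`. -/
noncomputable def invariantField (m : ℕ) (G : Subgroup (GL (Fin n) F)) :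
    IntermediateField F (RatField F m n) :=
  IntermediateField.fixedField (G.map (fieldAction F m n))

end Action

section Groups

variable {F : Type*} [Field F] {n : ℕ}

/-- The group of all `T ∈ GL_n(F)` with `T B ᵗ(σ T) = B`. -/
def isometryGroup (σ : F →+* F) (B : Matrix (Fin n) (Fin n) F) : Subgroup (GL (Fin n) F) where
  carrier := {T | T.val * B * (T.val.map σ)ᵀ = B}
  one_mem' := by simp [Matrix.map_one]
  mul_mem' {S T} hS hT := by
    simp only [Set.mem_ofPred_eq, Units.val_mul, Matrix.map_mul, Matrix.transpose_mul] at *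
    calc S.val * T.val * B * ((T.val.map σ)ᵀ * (S.val.map σ)ᵀ)
        = S.val * (T.val * B * (T.val.map σ)ᵀ) * (S.val.map σ)ᵀ := by
          simp only [Matrix.mul_assoc]
      _ = B := by rw [hT, hS]
  inv_mem' {T} hT := by
    simp only [Set.mem_ofPred_eq] at *
    have h1 : (T⁻¹).val * T.val = 1 := T.inv_val
    have h2 : (T.val.map σ)ᵀ * ((T⁻¹).val.map σ)ᵀ = 1 := by
      rw [← Matrix.transpose_mul, ← Matrix.map_mul, h1]
      simp [Matrix.map_one]
    calc (T⁻¹).val * B * ((T⁻¹).val.map σ)ᵀ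
        = (T⁻¹).val * (T.val * B * (T.val.map σ)ᵀ) * ((T⁻¹).val.map σ)ᵀ := by rw [hT]
      _ = ((T⁻¹).val * T.val) * B * ((T.val.map σ)ᵀ * ((T⁻¹).val.map σ)ᵀ) := by
          simp only [Matrix.mul_assoc]
      _ = B := by rw [h1, h2, Matrix.one_mul, Matrix.mul_one]

/-- The symplectic group `Sp(F, K) = {T | T K ᵗT = K}`. -/
def symplecticGroup (K : Matrix (Fin n) (Fin n) F) : Subgroup (GL (Fin n) F) :=
  isometryGroup (RingHom.id F) K

/-- The orthogonal group `O(F, A) = {T | T A ᵗT = A}`. -/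
def orthogonalGroup (A : Matrix (Fin n) (Fin n) F) : Subgroup (GL (Fin n) F) :=
  isometryGroup (RingHom.id F) A

theorem mem_symplecticGroup {K : Matrix (Fin n) (Fin n) F} {T : GL (Fin n) F} :
    T ∈ symplecticGroup K ↔ T.val * K * T.valᵀ = K := by
  change T.val * K * (T.val.map (fun x => x))ᵀ = K ↔ _
  rw [Matrix.map_id']

theorem mem_orthogonalGroup {A : Matrix (Fin n) (Fin n) F} {T : GL (Fin n) F} :
    T ∈ orthogonalGroup A ↔ T.val * A * T.valᵀ = A := by
  change T.val * A * (T.val.map (fun x => x))ᵀ = A ↔ _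
  rw [Matrix.map_id']

end Groups

section Unitary

variable {E : Type*} [Field E] {n : ℕ}

/-- The conjugation `a ↦ a ^ q` on `E`, where `q` is the order of the subfield `F`. It is the
involution of `E` over `F` when `E` is quadratic over `F`. -/
def conj (F E : Type*) [Field F] [Fintype F] [Field E] [Algebra F E] : E →+* E :=
  (FiniteField.frobeniusAlgHom F E).toRingHom

theorem conj_apply (F E : Type*) [Field F] [Fintype F] [Field E] [Algebra F E] (a : E) :
    conj F E a = a ^ Fintype.card F := rfl

/-- The unitary group `U(E, H) = {T | T H ᵗ(conj T) = H}`. -/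
def unitaryGroup (F : Type*) [Field F] [Fintype F] [Algebra F E]
    (H : Matrix (Fin n) (Fin n) E) : Subgroup (GL (Fin n) E) :=
  isometryGroup (conj F E) H

theorem mem_unitaryGroup {F : Type*} [Field F] [Fintype F] [Algebra F E]
    {H : Matrix (Fin n) (Fin n) E} {T : GL (Fin n) E} :
    T ∈ unitaryGroup F H ↔ T.val * H * (T.val.map (fun a => a ^ Fintype.card F))ᵀ = H :=
  Iff.rfl

end Unitary

section Forms

variable {F : Type*} [Field F] {m n : ℕ}

/-- The column vector `X_i ^ e = ᵗ(x_{i1} ^ e, …, x_{in} ^ e)`. -/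
noncomputable def coordVec (i : Fin m) (e : ℕ) : Fin n → CoordRing F m n :=
  fun l => X (i, l) ^ e

/-- The polynomial `ᵗX_i · B · X_j ^ e`. -/
noncomputable def formPoly (B : Matrix (Fin n) (Fin n) F) (i j : Fin m) (e : ℕ) :
    CoordRing F m n :=
  coordVec i 1 ⬝ᵥ (B.map C *ᵥ coordVec j e)

/-- `Q_{ij}^{(k)} = ᵗX_i · K · X_j ^ (q ^ k)`, where `q` is the order of `F`. -/
noncomputable def sympPoly [Fintype F] (K : Matrix (Fin n) (Fin n) F) (i j : Fin m) (k : ℕ) :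
    CoordRing F m n :=
  formPoly K i j (Fintype.card F ^ k)

/-- `P_{ij}^{(k)} = ᵗX_i · A · X_j ^ (q ^ k)`, where `q` is the order of `F`. -/
noncomputable def orthPoly [Fintype F] (A : Matrix (Fin n) (Fin n) F) (i j : Fin m) (k : ℕ) :
    CoordRing F m n :=
  formPoly A i j (Fintype.card F ^ k)

/-- `H_{ij}^{(k)} = ᵗX_i · H · X_j ^ (q ^ (2 k + 1))`, where `q` is the order of `F`. -/
noncomputable def unitPoly (F : Type*) [Fintype F] {E : Type*} [Field E] {m n : ℕ}
    (H : Matrix (Fin n) (Fin n) E) (i j : Fin m) (k : ℕ) : CoordRing E m n :=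
  formPoly H i j (Fintype.card F ^ (2 * k + 1))

/-- A polynomial regarded as a rational function. -/
noncomputable def toRat (f : CoordRing F m n) : RatField F m n :=
  algebraMap (CoordRing F m n) (RatField F m n) f

end Forms

end VectorInvariants

/-! ### A criterion for a set of polynomials to generate the invariant field -/

namespace VectorInvariants

open Matrix MvPolynomial

/-! Let `E` be the field of rational functions and `L` the subfield generated by the listed
invariants. Two facts give that `L` is the invariant field. First, every derivation of `E` that
kills the generators kills all coordinates, so `E/L` is separable algebraic. Second, every
`L`-embedding of `E` into an algebraically closed field is the restriction of some element of the
group, so an invariant has no conjugate but itself and lies in `L`. `invariantField_eq_adjoin` is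
this reduction; no order or degree is ever computed.

For the derivations, Frobenius powers are constants, so the conditions on `D X_i` form a linear
system whose matrix is the form times a Moore matrix of `X_1`, hence invertible. Only the orthogonal
generators with `k = 0` are not of this kind; there, odd characteristic lets one treat `X_1` first.

For the embeddings, the images `y_i` of the vectors `x_i` give the same values of the generators.
The Frobenius powers of `x_1` form a basis, so a unique `S` sends each of them to the same power of
`y_1`. Applying Frobenius to the given equations shows that `S` preserves the Gram matrix, and
pairing with a basis gives `y_i = S x_i`. It remains to see that `S` has entries in the finite
field, i.e. equals its own Frobenius twist. This is where the three families differ: the symplectic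
case uses one more Frobenius power, the unitary case takes the adjoint of the isometry relation
twisted by the conjugation, and the orthogonal case shows that an isometry of determinant one fixing
a hyperplane is trivial (`isometry_eq_one`). -/

theorem fieldAction_toRat {F : Type*} [Field F] {m n : ℕ} (T : GL (Fin n) F)
    (f : CoordRing F m n) : fieldAction F m n T (toRat f) = toRat (subst m T.val f) := by
  simp only [fieldAction, toRat, MonoidHom.comp_apply]
  exact IsFractionRing.fieldEquivOfAlgEquiv_algebraMap _ _ _ _ _

theorem mem_invariantField {F : Type*} [Field F] {m n : ℕ} {G : Subgroup (GL (Fin n) F)}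
    {f : RatField F m n} :
    f ∈ invariantField m G ↔ ∀ T ∈ G, fieldAction F m n T f = f := by
  simp [invariantField, IntermediateField.mem_fixedField_iff]

theorem ratField_algHom_ext {F A : Type*} [Field F] [Field A] [Algebra F A] {m n : ℕ}
    {f g : RatField F m n →ₐ[F] A} (h : ∀ p, f (toRat (X p)) = g (toRat (X p))) : f = g := by
  have h' : f.comp (Algebra.algHom F (CoordRing F m n) (RatField F m n)) =
      g.comp (Algebra.algHom F (CoordRing F m n) (RatField F m n)) :=
    MvPolynomial.algHom_ext h
  refine IsLocalization.algHom_ext (nonZeroDivisors (CoordRing F m n)) ?_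
  exact h'

/-- An `F`-derivation of `F(mW)` which kills the coordinates is zero. -/
theorem derivation_eq_zero {F M : Type*} [Field F] {m n : ℕ} [AddCommGroup M]
    [Module (RatField F m n) M] [Module F M]
    (D : Derivation F (RatField F m n) M) (h : ∀ p, D (toRat (X p)) = 0) : D = 0 := by
  have hp : ∀ f : CoordRing F m n, D (toRat f) = 0 := by
    intro f
    induction f using MvPolynomial.induction_on with
    | C a =>
      have : toRat (C a : CoordRing F m n) = algebraMap F (RatField F m n) a :=
        (IsScalarTower.algebraMap_apply F (CoordRing F m n) (RatField F m n) a).symm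
      rw [this, D.map_algebraMap]
    | add f g hf hg => simp only [toRat, map_add] at *; rw [hf, hg, add_zero]
    | mul_X f p hf =>
      have := h p
      simp only [toRat, map_mul, Derivation.leibniz] at *
      rw [hf, this, smul_zero, smul_zero, add_zero]
  ext a
  obtain ⟨f, g, hg, rfl⟩ := IsFractionRing.div_surjective (A := CoordRing F m n) a
  have hg0 : toRat g ≠ 0 := by
    simpa [toRat] using nonZeroDivisors.ne_zero hg
  have h1 := hp f
  have h2 := hp g
  have h3 : toRat f = toRat g * (toRat f / toRat g) := by field_simp
  rw [h3, D.leibniz, h2, smul_zero, add_zero] at h1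
  exact (smul_eq_zero.mp h1).resolve_left hg0

/-- In a separable algebraic extension, an element fixed by all embeddings into an algebraically
closed field lies in the base field. -/
theorem mem_range_of_forall_algHom_eq {L E Ω : Type*} [Field L] [Field E] [Field Ω] [Algebra L E]
    [Algebra L Ω] [Algebra E Ω] [IsScalarTower L E Ω] [IsAlgClosed Ω] [Algebra.IsSeparable L E]
    (a : E) (h : ∀ σ : E →ₐ[L] Ω, σ a = algebraMap E Ω a) : a ∈ (algebraMap L E).range := by
  rw [← minpoly.natDegree_eq_one_iff]
  have hs := Polynomial.card_rootSet_eq_natDegree (K := Ω) (Algebra.IsSeparable.isSeparable L a)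
    (IsAlgClosed.splits _)
  rw [← hs, Fintype.card_eq_one_iff]
  have hr := Algebra.IsAlgebraic.range_eval_eq_rootSet_minpoly (F := L) Ω a
  refine ⟨⟨algebraMap E Ω a, ?_⟩, ?_⟩
  · rw [← hr]
    exact ⟨IsScalarTower.toAlgHom L E Ω, rfl⟩
  · rintro ⟨y, hy⟩
    rw [← hr] at hy
    obtain ⟨σ, rfl⟩ := hy
    exact Subtype.ext (h σ)

/-- `hder` makes the Kähler differentials over the generated field vanish, hence the extension
separable algebraic; `hemb` identifies each of its embeddings with a group element. Algebraic
independence of `x` is passed on so that Moore determinants do not vanish. -/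
theorem invariantField_eq_adjoin {F : Type u} [Field F] {m n : ℕ} (G : Subgroup (GL (Fin n) F))
    (s : Set (CoordRing F m n))
    (hinv : ∀ T ∈ G, ∀ f ∈ s, subst m T.val f = f)
    (hder : ∀ (M : Type u) [AddCommGroup M] [Module (RatField F m n) M] [Module F M]
      (D : Derivation F (RatField F m n) M),
      (∀ f ∈ s, D (toRat f) = 0) → ∀ p, D (toRat (X p)) = 0)
    (hemb : ∀ (Ω : Type u) [Field Ω] [Algebra F Ω] (x y : Fin m × Fin n → Ω),
      AlgebraicIndependent F x → (∀ f ∈ s, aeval x f = aeval y f) →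
      ∃ T ∈ G, ∀ p, y p = ∑ l, algebraMap F Ω (T.val l p.2) * x (p.1, l)) :
    invariantField m G = IntermediateField.adjoin F (toRat '' s) := by
  set L := IntermediateField.adjoin F (toRat '' s) with hL
  have hsL : ∀ f ∈ s, toRat f ∈ L := fun f hf =>
    IntermediateField.subset_adjoin F _ ⟨f, hf, rfl⟩
  apply le_antisymm
  · have hF : Algebra.EssFiniteType F (RatField F m n) :=
      haveI := Algebra.EssFiniteType.of_isLocalization (RatField F m n)
        (nonZeroDivisors (CoordRing F m n))
      Algebra.EssFiniteType.comp F (CoordRing F m n) (RatField F m n)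
    have hLE : Algebra.EssFiniteType L (RatField F m n) := .of_comp F L _
    have hunr : Algebra.FormallyUnramified L (RatField F m n) := by
      refine ⟨?_⟩
      have hD := derivation_eq_zero ((KaehlerDifferential.D L (RatField F m n)).restrictScalars F)
        (hder _ _ fun f hf =>
          (KaehlerDifferential.D L (RatField F m n)).map_algebraMap ⟨toRat f, hsL f hf⟩)
      -- The differentials are spanned by the values of the universal derivation, which is zero by
      -- `hD`.
      rw [← Submodule.subsingleton_iff (RatField F m n), ← subsingleton_iff_bot_eq_top,
        ← KaehlerDifferential.span_range_derivation, eq_comm, Submodule.span_eq_bot]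
      rintro _ ⟨a, rfl⟩
      exact DFunLike.congr_fun hD a
    have hsep : Algebra.IsSeparable L (RatField F m n) :=
      Algebra.FormallyUnramified.isSeparable L (RatField F m n)
    intro a ha
    rw [mem_invariantField] at ha
    let Ω := AlgebraicClosure (RatField F m n)
    have := mem_range_of_forall_algHom_eq (L := L) (Ω := Ω) a ?_
    · obtain ⟨b, rfl⟩ := this
      exact b.2
    intro σ
    have hx : AlgebraicIndependent F
        (fun p => algebraMap (RatField F m n) Ω (toRat (X p : CoordRing F m n))) := by
      have h1 := MvPolynomial.algebraicIndependent_X (Fin m × Fin n) F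
      exact h1.map' (f := (IsScalarTower.toAlgHom F (RatField F m n) Ω).comp
        (Algebra.algHom F (CoordRing F m n) (RatField F m n)))
        ((algebraMap (RatField F m n) Ω).injective.comp (IsFractionRing.injective _ _))
    let τ : RatField F m n →ₐ[F] Ω := σ.restrictScalars F
    let ι : RatField F m n →ₐ[F] Ω := IsScalarTower.toAlgHom F (RatField F m n) Ω
    have haev : ∀ (ρ : RatField F m n →ₐ[F] Ω) (f : CoordRing F m n),
        aeval (fun p => ρ (toRat (X p))) f = ρ (toRat f) := by
      intro ρ f
      have : aeval (fun p => ρ (toRat (X p))) =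
          ρ.comp (Algebra.algHom F (CoordRing F m n) (RatField F m n)) := by
        refine MvPolynomial.algHom_ext fun p => ?_
        rw [aeval_X]
        rfl
      exact DFunLike.congr_fun this f
    obtain ⟨T, hT, hxT⟩ := hemb Ω (fun p => ι (toRat (X p))) (fun p => τ (toRat (X p))) hx (by
      intro f hf
      rw [haev, haev]
      exact (σ.commutes ⟨toRat f, hsL f hf⟩).symm)
    -- The embedding is the inclusion composed with the action of `T`, so it fixes the invariant
    -- `a`.
    have key : τ = ι.comp (fieldAction F m n T).toAlgHom := by
      refine ratField_algHom_ext fun p => ?_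
      change _ = ι (fieldAction F m n T (toRat (X p)))
      rw [hxT, fieldAction_toRat, ← haev]
      simp [subst]
    change τ a = ι a
    rw [key]
    exact congrArg ι (ha T hT)
  · rw [hL, IntermediateField.adjoin_le_iff]
    rintro _ ⟨f, hf, rfl⟩
    simp only [SetLike.mem_coe, mem_invariantField]
    intro T hT
    rw [fieldAction_toRat, hinv T hT f hf]

/-! ### Isometries recovered from the Frobenius powers of one vector -/

section FrobeniusGeometry

variable {Ω : Type*} [Field Ω] {n : ℕ}

/-- The matrix with columns `v, φ v, …, φ ^ (n - 1) v`, for an endomorphism `φ` of the field. -/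
def mooreMatrix (φ : Ω →+* Ω) (v : Fin n → Ω) : Matrix (Fin n) (Fin n) Ω :=
  of fun l k => (φ ^ (k : ℕ)) (v l)

theorem col_mooreMatrix (φ : Ω →+* Ω) (v : Fin n → Ω) (k : Fin n) :
    (mooreMatrix φ v).col k = (φ ^ (k : ℕ)) ∘ v := rfl

theorem col_mooreMatrix_map (φ τ : Ω →+* Ω) (v : Fin n → Ω) (k : Fin n) :
    ((mooreMatrix φ v).map τ).col k = (τ * φ ^ (k : ℕ)) ∘ v := rfl

theorem det_map_ne_zero (φ : Ω →+* Ω) {M : Matrix (Fin n) (Fin n) Ω} (h : M.det ≠ 0) :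
    (M.map φ).det ≠ 0 := by
  rw [← RingHom.mapMatrix_apply, ← RingHom.map_det]
  simpa using h

theorem map_pow_eq {φ : Ω →+* Ω} {B : Matrix (Fin n) (Fin n) Ω} (h : B.map φ = B) (k : ℕ) :
    B.map (φ ^ k) = B := by
  induction k with
  | zero => ext; simp
  | succ k ih =>
    ext i j
    have h1 := congrFun (congrFun ih i) j
    have h2 := congrFun (congrFun h i) j
    simp only [map_apply] at *
    rw [pow_succ, RingHom.mul_def, RingHom.comp_apply, h2, h1]

theorem mul_comp_vec (φ τ : Ω →+* Ω) (v : Fin n → Ω) : ⇑(φ * τ) ∘ v = φ ∘ τ ∘ v := rfl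

theorem map_form (φ : Ω →+* Ω) (B : Matrix (Fin n) (Fin n) Ω) (u v : Fin n → Ω) :
    φ (u ⬝ᵥ B *ᵥ v) = (φ ∘ u) ⬝ᵥ B.map φ *ᵥ (φ ∘ v) := by
  rw [RingHom.map_dotProduct]
  congr 1
  ext i
  exact RingHom.map_mulVec _ _ _ _

theorem eq_of_forall_dotProduct_col {M : Matrix (Fin n) (Fin n) Ω} (hM : M.det ≠ 0)
    {u v : Fin n → Ω} (h : ∀ k, u ⬝ᵥ M.col k = v ⬝ᵥ M.col k) : u = v := by
  have hM' : IsUnit M := (isUnit_iff_isUnit_det _).2 hM.isUnit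
  exact vecMul_injective_of_isUnit hM' (funext h)

theorem eq_of_forall_mulVec_col {M S T : Matrix (Fin n) (Fin n) Ω} (hM : M.det ≠ 0)
    (h : ∀ k, S *ᵥ M.col k = T *ᵥ M.col k) : S = T := by
  ext i j
  exact congrFun (eq_of_forall_dotProduct_col hM (u := S i) (v := T i)
    fun k => congrFun (h k) i) j

theorem exists_mulVec_col_eq {M : Matrix (Fin n) (Fin n) Ω} (hM : M.det ≠ 0)
    (N : Matrix (Fin n) (Fin n) Ω) :
    ∃ S : Matrix (Fin n) (Fin n) Ω, ∀ k, S *ᵥ M.col k = N.col k := by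
  refine ⟨N * M⁻¹, fun k => ?_⟩
  have : N * M⁻¹ * M = N := nonsing_inv_mul_cancel_right _ _ hM.isUnit
  ext i
  exact congrFun (congrFun this i) k

/-- If `S` and `S'` preserve the values of a form on the columns of two invertible matrices,
they are adjoint isometries. -/
theorem transpose_mul_mul_eq {M M' S S' B B' : Matrix (Fin n) (Fin n) Ω} (hM : M.det ≠ 0)
    (hM' : M'.det ≠ 0)
    (h : ∀ j k, (S *ᵥ M.col j) ⬝ᵥ B *ᵥ (S' *ᵥ M'.col k) = M.col j ⬝ᵥ B' *ᵥ M'.col k) :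
    Sᵀ * B * S' = B' := by
  refine eq_of_forall_mulVec_col hM' fun k => eq_of_forall_dotProduct_col hM fun j => ?_
  rw [dotProduct_comm, dotProduct_comm _ (M.col j), ← h j k, ← mulVec_mulVec, ← mulVec_mulVec,
    dotProduct_mulVec, vecMul_transpose]

theorem det_ne_zero_of_transpose_mul_mul {S S' B : Matrix (Fin n) (Fin n) Ω} (hB : B.det ≠ 0)
    (h : Sᵀ * B * S' = B) : S.det ≠ 0 ∧ S'.det ≠ 0 := by
  have := congrArg det h
  rw [det_mul, det_mul, det_transpose] at this
  constructor <;> rintro h0 <;> simp [h0] at this <;> exact hB this.symm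

/-- An isometry sends `x` to `y` once the forms `(x, v)` and `(y, S' v)` agree on a basis. -/
theorem eq_mulVec_of_form_eq {M S S' B : Matrix (Fin n) (Fin n) Ω} (hM : M.det ≠ 0)
    (hB : B.det ≠ 0) (hS : Sᵀ * B * S' = B) {x y : Fin n → Ω}
    (h : ∀ k, y ⬝ᵥ B *ᵥ (S' *ᵥ M.col k) = x ⬝ᵥ B *ᵥ M.col k) : y = S *ᵥ x := by
  have hS' := (det_ne_zero_of_transpose_mul_mul hB hS).2
  have hN : (B * S').det ≠ 0 := by rw [det_mul]; exact mul_ne_zero hB hS'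
  have h1 : y ᵥ* (B * S') = x ᵥ* B := by
    refine eq_of_forall_dotProduct_col hM fun k => ?_
    rw [← dotProduct_mulVec, ← dotProduct_mulVec, ← h k, mulVec_mulVec]
  have h2 : (S *ᵥ x) ᵥ* (B * S') = x ᵥ* B := by
    rw [← vecMul_transpose, vecMul_vecMul, ← Matrix.mul_assoc, hS]
  exact vecMul_injective_of_isUnit ((isUnit_iff_isUnit_det _).2 hN.isUnit) (h1.trans h2.symm)

/-- The values of a `φ`-invariant form on the Frobenius powers of a vector are determined by the
values on the pairs `(x, φ ^ k x)` and `(φ ^ k x, x)`. -/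
theorem form_pow_eq {φ : Ω →+* Ω} {B : Matrix (Fin n) (Fin n) Ω} (hB : B.map φ = B)
    {x y : Fin n → Ω} {N : ℕ}
    (h : ∀ k ≤ N, x ⬝ᵥ B *ᵥ ((φ ^ k) ∘ x) = y ⬝ᵥ B *ᵥ ((φ ^ k) ∘ y))
    (h' : ∀ k ≤ N, ((φ ^ k) ∘ x) ⬝ᵥ B *ᵥ x = ((φ ^ k) ∘ y) ⬝ᵥ B *ᵥ y)
    {j k : ℕ} (hj : j ≤ N) (hk : k ≤ N) :
    ((φ ^ j) ∘ x) ⬝ᵥ B *ᵥ ((φ ^ k) ∘ x) = ((φ ^ j) ∘ y) ⬝ᵥ B *ᵥ ((φ ^ k) ∘ y) := by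
  rcases le_total j k with hjk | hjk
  · obtain ⟨d, rfl⟩ := Nat.exists_eq_add_of_le hjk
    have := congrArg (φ ^ j) (h d (by omega))
    rw [map_form, map_form, map_pow_eq hB] at this
    simpa only [pow_add, RingHom.mul_def, RingHom.coe_comp, Function.comp_assoc] using this
  · obtain ⟨d, rfl⟩ := Nat.exists_eq_add_of_le hjk
    have := congrArg (φ ^ k) (h' d (by omega))
    rw [map_form, map_form, map_pow_eq hB] at this
    simpa only [pow_add, RingHom.mul_def, RingHom.coe_comp, Function.comp_assoc] using this

theorem map_mulVec_comp (φ : Ω →+* Ω) (S : Matrix (Fin n) (Fin n) Ω) (v : Fin n → Ω) :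
    S.map φ *ᵥ (φ ∘ v) = φ ∘ (S *ᵥ v) := by
  ext i
  exact (RingHom.map_mulVec _ _ _ _).symm

theorem form_swap {B : Matrix (Fin n) (Fin n) Ω} (u v : Fin n → Ω) :
    u ⬝ᵥ B *ᵥ v = v ⬝ᵥ Bᵀ *ᵥ u := by
  rw [mulVec_transpose, dotProduct_comm v, ← dotProduct_mulVec]

/-- The terms at `(i, j)` and `(j, i)` cancel; the zero diagonal is needed in characteristic two. -/
theorem form_self_eq_zero {K : Matrix (Fin n) (Fin n) Ω} (hK : Kᵀ = -K) (hd : ∀ i, K i i = 0)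
    (u : Fin n → Ω) : u ⬝ᵥ K *ᵥ u = 0 := by
  simp only [dotProduct, mulVec, Finset.mul_sum]
  rw [← Finset.sum_product']
  refine Finset.sum_involution (fun p _ => (p.2, p.1)) ?_ ?_ ?_ ?_
  · rintro ⟨i, j⟩ -
    have : K j i = - K i j := congrFun (congrFun hK i) j
    simp only [this]; ring
  · rintro ⟨i, j⟩ - hne heq
    simp only [Prod.mk.injEq] at heq
    obtain ⟨rfl, -⟩ := heq
    simp [hd] at hne
  · simp
  · simp

/-- The value at `k = 0` is free because the form is alternating, so the range `1 ≤ k ≤ n` controls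
one Frobenius power beyond the basis. Hence `S` is also known on the shifted basis `φ x, …, φ ^ n
x`, where it agrees with its twist. -/
theorem exists_symplectic_of_form_eq {m : ℕ} {φ : Ω →+* Ω} {K : Matrix (Fin n) (Fin n) Ω}
    (hK : Kᵀ = -K) (hd : ∀ i, K i i = 0) (hdet : K.det ≠ 0) (hφ : K.map φ = K)
    {x y : Fin m → Fin n → Ω} (i₀ : Fin m) (hx : (mooreMatrix φ (x i₀)).det ≠ 0)
    (h : ∀ i k, 1 ≤ k → k ≤ n →
      x i ⬝ᵥ K *ᵥ ((φ ^ k) ∘ x i₀) = y i ⬝ᵥ K *ᵥ ((φ ^ k) ∘ y i₀)) :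
    ∃ S : Matrix (Fin n) (Fin n) Ω, S.map φ = S ∧ Sᵀ * K * S = K ∧ ∀ i, y i = S *ᵥ x i := by
  have h0 : ∀ k ≤ n, x i₀ ⬝ᵥ K *ᵥ ((φ ^ k) ∘ x i₀) = y i₀ ⬝ᵥ K *ᵥ ((φ ^ k) ∘ y i₀) := by
    intro k hk
    rcases Nat.eq_zero_or_pos k with rfl | hk0
    · have : ∀ v : Fin n → Ω, ⇑(φ ^ 0) ∘ v = v := fun v => by
        rw [pow_zero]; rfl
      rw [this, this, form_self_eq_zero hK hd, form_self_eq_zero hK hd]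
    · exact h i₀ k hk0 hk
  have hpow := fun j k hj hk => form_pow_eq hφ h0 (fun k hk => by
    rw [form_swap, form_swap _ (y i₀), hK, neg_mulVec, neg_mulVec, dotProduct_neg,
      dotProduct_neg, h0 k hk]) (j := j) (k := k) hj hk
  obtain ⟨S, hS⟩ := exists_mulVec_col_eq hx (mooreMatrix φ (y i₀))
  simp only [col_mooreMatrix] at hS
  have hiso : Sᵀ * K * S = K := by
    refine transpose_mul_mul_eq hx hx fun j k => ?_
    simp only [col_mooreMatrix, hS]
    exact (hpow j k j.2.le k.2.le).symm
  have hM' : ((mooreMatrix φ (x i₀)).map φ).det ≠ 0 := det_map_ne_zero φ hx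
  -- The vector `φ ^ n x` is outside the defining basis, but its pairings with that basis are known
  -- and determine its image.
  have hlast : S *ᵥ ((φ ^ n) ∘ x i₀) = (φ ^ n) ∘ y i₀ := by
    refine (eq_mulVec_of_form_eq hx (B := K) hdet hiso fun k => ?_).symm
    rw [col_mooreMatrix, hS, form_swap, form_swap ((φ ^ n) ∘ x i₀), hK, neg_mulVec, neg_mulVec,
      dotProduct_neg, dotProduct_neg, hpow k n k.2.le le_rfl]
  have hS' : ∀ k : Fin n, S *ᵥ ((mooreMatrix φ (x i₀)).map φ).col k =
      ((mooreMatrix φ (y i₀)).map φ).col k := by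
    intro k
    rw [col_mooreMatrix_map, col_mooreMatrix_map, ← pow_succ']
    rcases Nat.lt_or_ge (k + 1) n with hk | hk
    · exact hS ⟨k + 1, hk⟩
    · have : (k : ℕ) + 1 = n := by omega
      rw [this, hlast]
  refine ⟨S, ?_, hiso, fun i => ?_⟩
  · refine eq_of_forall_mulVec_col hM' fun k => ?_
    rw [hS', col_mooreMatrix_map, col_mooreMatrix_map, mul_comp_vec, mul_comp_vec,
      map_mulVec_comp, hS]
  · refine eq_mulVec_of_form_eq hM' hdet hiso fun k => ?_
    rw [hS', col_mooreMatrix_map, col_mooreMatrix_map, ← pow_succ', h i _ (by omega) (by omega)]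

/-- Here `τ` is the conjugation and `τ ^ 2` the Frobenius of the larger field. Twisting the relation
for `S` and `S.map τ` by `τ` and transposing gives the same relation with `S.map (τ ^ 2)` in place
of `S`; cancelling `H * S.map τ` gives equality. -/
theorem exists_unitary_of_form_eq {m : ℕ} {τ : Ω →+* Ω} {H : Matrix (Fin n) (Fin n) Ω}
    (hH : H.map τ = Hᵀ) (hdet : H.det ≠ 0)
    {x y : Fin m → Fin n → Ω} (i₀ : Fin m) (hx : (mooreMatrix (τ ^ 2) (x i₀)).det ≠ 0)
    (h : ∀ i k, k < n →
      x i ⬝ᵥ H *ᵥ ((τ ^ (2 * k + 1)) ∘ x i₀) = y i ⬝ᵥ H *ᵥ ((τ ^ (2 * k + 1)) ∘ y i₀)) :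
    ∃ S : Matrix (Fin n) (Fin n) Ω, S.map ⇑(τ ^ 2) = S ∧ Sᵀ * H * S.map τ = H ∧
      ∀ i, y i = S *ᵥ x i := by
  have hHτ : H.map ⇑(τ ^ 2) = H := by
    have : H.map ⇑(τ ^ 2) = (H.map τ).map τ := by
      ext i j; simp only [map_apply, pow_two]; rfl
    rw [this, hH, transpose_map, hH, transpose_transpose]
  have hpow : ∀ j k, j < n → k < n →
      (⇑((τ ^ 2) ^ j) ∘ x i₀) ⬝ᵥ H *ᵥ (⇑(τ * (τ ^ 2) ^ k) ∘ x i₀) =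
        (⇑((τ ^ 2) ^ j) ∘ y i₀) ⬝ᵥ H *ᵥ (⇑(τ * (τ ^ 2) ^ k) ∘ y i₀) := by
    intro j k hj hk
    -- When `k < j`, an odd power of `τ` is applied: it turns `H` into its transpose and so
    -- exchanges the two arguments.
    rcases Nat.lt_or_ge k j with hjk | hjk
    · obtain ⟨d, rfl⟩ := Nat.exists_eq_add_of_lt hjk
      have := congrArg ⇑(τ * (τ ^ 2) ^ k) (h i₀ d (by omega))
      have hm : H.map ⇑(τ * (τ ^ 2) ^ k) = Hᵀ := by
        have h1 := map_pow_eq hHτ k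
        rw [← hH]
        ext i j
        have := congrFun (congrFun h1 i) j
        simp only [map_apply, RingHom.mul_def, RingHom.comp_apply] at *
        rw [this]
      rw [map_form, map_form, hm, ← form_swap, ← form_swap] at this
      have he : (τ ^ 2) ^ (k + d + 1) = τ * (τ ^ 2) ^ k * τ ^ (2 * d + 1) := by
        rw [← pow_mul, ← pow_mul, ← pow_succ', ← pow_add]; congr 1; ring
      rw [he, RingHom.mul_def (τ * (τ ^ 2) ^ k), RingHom.coe_comp]
      exact this
    · obtain ⟨d, rfl⟩ := Nat.exists_eq_add_of_le hjk
      have := congrArg ⇑((τ ^ 2) ^ j) (h i₀ d (by omega))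
      rw [map_form, map_form, map_pow_eq hHτ] at this
      have he : τ * (τ ^ 2) ^ (j + d) = (τ ^ 2) ^ j * τ ^ (2 * d + 1) := by
        rw [← pow_mul, ← pow_mul, ← pow_succ', ← pow_add]; congr 1; ring
      rw [he, RingHom.mul_def, RingHom.coe_comp]
      exact this
  obtain ⟨S, hS⟩ := exists_mulVec_col_eq hx (mooreMatrix (τ ^ 2) (y i₀))
  simp only [col_mooreMatrix] at hS
  have hM' : ((mooreMatrix (τ ^ 2) (x i₀)).map τ).det ≠ 0 := det_map_ne_zero τ hx
  have hS' : ∀ k : Fin n, S.map τ *ᵥ ((mooreMatrix (τ ^ 2) (x i₀)).map τ).col k =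
      ((mooreMatrix (τ ^ 2) (y i₀)).map τ).col k := by
    intro k
    rw [col_mooreMatrix_map, col_mooreMatrix_map, mul_comp_vec, mul_comp_vec,
      map_mulVec_comp, hS]
  have hiso : Sᵀ * H * S.map τ = H := by
    refine transpose_mul_mul_eq hx hM' fun j k => ?_
    rw [hS', col_mooreMatrix, col_mooreMatrix_map, col_mooreMatrix_map, hS]
    exact (hpow j k j.2 k.2).symm
  refine ⟨S, ?_, hiso, fun i => ?_⟩
  · have hss : S.map ⇑(τ ^ 2) = (S.map τ).map τ := by
      ext i j; simp only [map_apply, pow_two]; rfl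
    have h1 : (S.map ⇑(τ ^ 2))ᵀ * H * S.map τ = H := by
      have h2 := congrArg (fun A => (Matrix.map A τ)ᵀ) hiso
      simp only [Matrix.map_mul, transpose_mul, transpose_map, hH, transpose_transpose] at h2
      rw [hss, Matrix.mul_assoc]
      exact h2
    have hu : IsUnit (H * S.map τ) := by
      rw [isUnit_iff_isUnit_det, det_mul]
      exact (mul_ne_zero hdet (det_ne_zero_of_transpose_mul_mul hdet hiso).2).isUnit
    apply transpose_injective
    apply hu.mul_right_cancel
    rw [← Matrix.mul_assoc, ← Matrix.mul_assoc, h1, hiso]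
  · refine eq_mulVec_of_form_eq hM' hdet hiso fun k => ?_
    have he : τ * (τ ^ 2) ^ (k : ℕ) = τ ^ (2 * (k : ℕ) + 1) := by
      rw [← pow_mul, ← pow_succ']
    rw [hS', col_mooreMatrix_map, col_mooreMatrix_map, he, h i k k.2]

/-- An isometry of determinant one of a nonsingular symmetric form which fixes all but one of the
vectors of a basis is the identity. -/
theorem isometry_eq_one {B C : Matrix (Fin n) (Fin n) Ω} (h2 : (2 : Ω) ≠ 0) (hB : Bᵀ = B)
    (hdet : B.det ≠ 0) (hC : Cᵀ * B * C = B) (hC1 : C.det = 1) (i₀ : Fin n)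
    (hfix : ∀ i, i ≠ i₀ → C.col i = Pi.single i 1) : C = 1 := by
  set c := C.col i₀ with hc
  have hup : C = (1 : Matrix (Fin n) (Fin n) Ω).updateCol i₀ c := by
    ext i j
    rcases eq_or_ne j i₀ with rfl | hj
    · simp [hc]
    · rw [updateCol_ne hj]
      have := congrFun (hfix j hj) i
      simpa [Matrix.one_apply, Pi.single_apply] using this
  -- By Cramer's rule, the determinant of the identity with column `i₀` replaced by `c` is `c i₀`.
  have hci : c i₀ = 1 := by
    rw [hup, ← cramer_apply, cramer_one] at hC1
    exact hC1
  set e : Fin n → Ω := Pi.single i₀ 1 with he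
  set u := c - e with hu
  have hui : u i₀ = 0 := by simp [hu, he, hci]
  have hform : ∀ v w, (C *ᵥ v) ⬝ᵥ B *ᵥ (C *ᵥ w) = v ⬝ᵥ B *ᵥ w := by
    intro v w
    conv_rhs => rw [← hC]
    rw [← mulVec_mulVec, ← mulVec_mulVec, dotProduct_mulVec v, vecMul_transpose]
  have hCe : C *ᵥ e = e + u := by
    rw [he, mulVec_single_one, hu, add_sub_cancel]
  have hCi : ∀ i, i ≠ i₀ → (Pi.single i 1 : Fin n → Ω) ⬝ᵥ B *ᵥ u = 0 := by
    intro i hi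
    have := hform (Pi.single i 1) e
    rw [hCe, mulVec_single_one, hfix i hi, mulVec_add, dotProduct_add] at this
    exact left_eq_add.mp this.symm
  -- Since `u i₀ = 0`, `u` is a combination of the fixed basis vectors, all of them orthogonal to
  -- `u`.
  have huu : u ⬝ᵥ B *ᵥ u = 0 := by
    refine Finset.sum_eq_zero fun i _ => ?_
    rcases eq_or_ne i i₀ with rfl | hi
    · rw [hui, zero_mul]
    · have := hCi i hi
      rw [single_one_dotProduct] at this
      rw [this, mul_zero]
  have heu : e ⬝ᵥ B *ᵥ u = 0 := by
    have := hform e e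
    rw [hCe, mulVec_add, dotProduct_add, add_dotProduct, add_dotProduct, huu,
      form_swap u e, hB] at this
    have h3 : 2 * (e ⬝ᵥ B *ᵥ u) = 0 := by linear_combination this
    exact (mul_eq_zero.mp h3).resolve_left h2
  have hBu : B *ᵥ u = 0 := by
    ext i
    rw [Pi.zero_apply, ← single_one_dotProduct i (B *ᵥ u)]
    rcases eq_or_ne i i₀ with rfl | hi
    · exact heu
    · exact hCi i hi
  have hu0 : u = 0 := by
    by_contra h
    exact hdet (exists_mulVec_eq_zero_iff.mp ⟨u, h, hBu⟩)
  rw [hup, sub_eq_zero.mp hu0]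
  ext i j
  rcases eq_or_ne j i₀ with rfl | hj
  · simp [he, Matrix.one_apply, Pi.single_apply]
  · rw [updateCol_ne hj]

/-- With `k < n` only, `S` and its twist are seen to agree just on `φ x, …, φ ^ (n - 1) x`. Their
quotient is an isometry fixing these `n - 1` vectors; its determinant is one because `det S = ±1` is
Frobenius invariant, which rules out a reflection. -/
theorem exists_orthogonal_of_form_eq {m : ℕ} {φ : Ω →+* Ω} {A : Matrix (Fin n) (Fin n) Ω}
    (h2 : (2 : Ω) ≠ 0) (hA : Aᵀ = A) (hdet : A.det ≠ 0) (hφ : A.map φ = A)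
    {x y : Fin m → Fin n → Ω} (i₀ : Fin m) (hx : (mooreMatrix φ (x i₀)).det ≠ 0)
    (h : ∀ i k, k < n →
      x i ⬝ᵥ A *ᵥ ((φ ^ k) ∘ x i₀) = y i ⬝ᵥ A *ᵥ ((φ ^ k) ∘ y i₀)) :
    ∃ S : Matrix (Fin n) (Fin n) Ω, S.map φ = S ∧ Sᵀ * A * S = A ∧ ∀ i, y i = S *ᵥ x i := by
  obtain ⟨S, hS⟩ := exists_mulVec_col_eq hx (mooreMatrix φ (y i₀))
  simp only [col_mooreMatrix] at hS
  have hiso : Sᵀ * A * S = A := by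
    refine transpose_mul_mul_eq hx hx fun j k => ?_
    simp only [col_mooreMatrix, hS]
    have hj := j.2
    have h0 : ∀ k ≤ n - 1, x i₀ ⬝ᵥ A *ᵥ ((φ ^ k) ∘ x i₀) = y i₀ ⬝ᵥ A *ᵥ ((φ ^ k) ∘ y i₀) :=
      fun k' hk => h i₀ k' (by omega)
    exact (form_pow_eq (N := n - 1) hφ h0 (fun k hk => by
      rw [form_swap, form_swap _ (y i₀), hA, h0 k hk]) (by omega) (by omega)).symm
  refine ⟨S, ?_, hiso, fun i => eq_mulVec_of_form_eq hx hdet hiso fun k => ?_⟩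
  swap
  · simp only [col_mooreMatrix, hS]
    exact (h i k k.2).symm
  rcases Nat.eq_zero_or_pos n with rfl | hn
  · exact Subsingleton.elim _ _
  have hdS : S.det ≠ 0 := (det_ne_zero_of_transpose_mul_mul hdet hiso).1
  have hdS2 : S.det ^ 2 = 1 := by
    have := congrArg det hiso
    rw [det_mul, det_mul, det_transpose] at this
    apply mul_right_cancel₀ hdet
    linear_combination this
  set M' := (mooreMatrix φ (x i₀)).map φ with hMdef
  have hM' : M'.det ≠ 0 := det_map_ne_zero φ hx
  have hiso' : (S.map φ)ᵀ * A * S.map φ = A := by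
    have := congrArg (fun B => Matrix.map B φ) hiso
    simpa only [Matrix.map_mul, transpose_map, hφ] using this
  have hdS' : (S.map φ).det = S.det := by
    rw [← RingHom.mapMatrix_apply, ← RingHom.map_det]
    rcases eq_or_eq_neg_of_sq_eq_sq S.det 1 (by rw [hdS2, one_pow]) with h | h <;> simp [h]
  have hSS : S * S⁻¹ = 1 := mul_nonsing_inv _ hdS.isUnit
  have hMM : M' * M'⁻¹ = 1 := mul_nonsing_inv _ hM'.isUnit
  -- The quotient of the twist by `S`, written in the basis `φ x, …, φ ^ n x`; only its last column
  -- is not yet known.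
  set C := M'⁻¹ * (S⁻¹ * S.map φ) * M' with hCdef
  have hSMC : S * M' * C = S.map φ * M' := by
    rw [hCdef]
    calc S * M' * (M'⁻¹ * (S⁻¹ * S.map φ) * M')
        = S * (M' * M'⁻¹) * S⁻¹ * S.map φ * M' := by simp only [Matrix.mul_assoc]
      _ = S.map φ * M' := by rw [hMM, Matrix.mul_one, hSS, Matrix.one_mul]
  have hSM : IsUnit (S * M') := by
    rw [isUnit_iff_isUnit_det, det_mul]
    exact (mul_ne_zero hdS hM').isUnit
  have hC1 : C = 1 := by
    refine isometry_eq_one (B := M'ᵀ * A * M') h2 ?_ ?_ ?_ ?_ ⟨n - 1, by omega⟩ ?_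
    · simp only [transpose_mul, transpose_transpose, hA, Matrix.mul_assoc]
    · rw [det_mul, det_mul, det_transpose]
      exact mul_ne_zero (mul_ne_zero hM' hdet) hM'
    · calc Cᵀ * (M'ᵀ * A * M') * C = Cᵀ * (M'ᵀ * (Sᵀ * A * S) * M') * C := by rw [hiso]
        _ = (S * M' * C)ᵀ * A * (S * M' * C) := by
          simp only [transpose_mul, Matrix.mul_assoc]
        _ = M'ᵀ * ((S.map φ)ᵀ * A * S.map φ) * M' := by
          rw [hSMC]; simp only [transpose_mul, Matrix.mul_assoc]
        _ = _ := by rw [hiso']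
    · have := congrArg det hSMC
      rw [det_mul, det_mul, det_mul (S.map φ), hdS'] at this
      exact mul_left_cancel₀ (mul_ne_zero hdS hM') (this.trans (mul_one _).symm)
    · intro k hk
      have hk' : (k : ℕ) + 1 < n := by
        have : (k : ℕ) ≠ n - 1 := fun h => hk (Fin.ext h)
        omega
      apply mulVec_injective_of_isUnit hSM
      have h3 : (S * M') *ᵥ C.col k = (S * M' * C).col k := rfl
      have h4 : (S.map φ * M').col k = S.map φ *ᵥ M'.col k := rfl
      have h5 : (S * M').col k = S *ᵥ M'.col k := rfl
      rw [h3, hSMC, h4, mulVec_single_one, h5, hMdef, col_mooreMatrix_map, ← pow_succ']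
      rw [hS ⟨k + 1, hk'⟩, pow_succ', mul_comp_vec, mul_comp_vec, map_mulVec_comp, hS]
  rw [hC1, Matrix.mul_one] at hSMC
  exact ((isUnit_iff_isUnit_det _).2 hM'.isUnit).mul_right_cancel hSMC.symm

end FrobeniusGeometry

/-! ### Fixed points of Frobenius, Moore determinants, descent to the finite field -/

section Frobenius

variable {F Ω : Type*} [Field F] [Fintype F] [Field Ω] [Algebra F Ω] {n : ℕ}

theorem conj_pow_apply (k : ℕ) (a : Ω) : (conj F Ω ^ k) a = a ^ Fintype.card F ^ k := by
  induction k with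
  | zero => simp
  | succ k ih =>
    rw [pow_succ', RingHom.mul_def, RingHom.comp_apply, ih, conj_apply, ← pow_mul, ← pow_succ]

theorem conj_algebraMap (a : F) : conj F Ω (algebraMap F Ω a) = algebraMap F Ω a :=
  (FiniteField.frobeniusAlgHom F Ω).commutes a

/-- Otherwise `X ^ q - X` would have `q + 1` roots: the elements of `F`, and `a`, indexed by `none`.
-/
theorem mem_range_of_conj_eq {a : Ω} (ha : conj F Ω a = a) : ∃ b, algebraMap F Ω b = a := by
  by_contra! h
  have hr : 1 < Fintype.card F := Fintype.one_lt_card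
  refine FiniteField.X_pow_card_sub_X_ne_zero Ω hr ?_
  refine Polynomial.eq_zero_of_natDegree_lt_card_of_eval_eq_zero _
    (f := fun o : Option F => o.elim a (algebraMap F Ω)) ?_ ?_ ?_
  · rintro (_ | b) (_ | c) hbc
    · rfl
    · exact absurd hbc.symm (h c)
    · exact absurd hbc (h b)
    · exact congrArg some ((algebraMap F Ω).injective hbc)
  · rintro (_ | b)
    · simpa [sub_eq_zero, ← conj_apply] using ha
    · simp [← map_pow, FiniteField.pow_card]
  · rw [FiniteField.X_pow_card_sub_X_natDegree_eq Ω hr, Fintype.card_option]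
    exact Nat.lt_succ_self _

/-- A kernel vector gives the coefficients of a `q`-polynomial of degree at most `q ^ (n - 1)`
vanishing on the `F`-span of `v`, which has `q ^ n` elements. So all coefficients are zero. -/
theorem det_mooreMatrix_ne_zero {v : Fin n → Ω} (hv : LinearIndependent F v) :
    (mooreMatrix (conj F Ω) v).det ≠ 0 := by
  intro h
  obtain ⟨c, hc0, hc⟩ := exists_mulVec_eq_zero_iff.mpr h
  have hr : 1 < Fintype.card F := Fintype.one_lt_card
  apply hc0
  let p : Polynomial Ω := ∑ k : Fin n, Polynomial.C (c k) * Polynomial.X ^ Fintype.card F ^ (k : ℕ)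
  have hp : p = 0 := by
    refine Polynomial.eq_zero_of_natDegree_lt_card_of_eval_eq_zero p
      (f := fun a : Fin n → F => ∑ l, a l • v l) ?_ ?_ ?_
    · intro a b hab
      have := Fintype.linearIndependent_iff.mp hv (a - b) (by
        simp only [Pi.sub_apply, sub_smul, Finset.sum_sub_distrib]
        exact sub_eq_zero.mpr hab)
      ext l
      exact sub_eq_zero.mp (this l)
    · intro a
      have h1 : ∀ k : ℕ, (∑ l, a l • v l) ^ Fintype.card F ^ k =
          ∑ l, a l • (conj F Ω ^ k) (v l) := by
        intro k
        rw [← conj_pow_apply (F := F), map_sum]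
        refine Finset.sum_congr rfl fun l _ => ?_
        rw [Algebra.smul_def, Algebra.smul_def, map_mul, conj_pow_apply (F := F) k (algebraMap F Ω _),
          ← map_pow, FiniteField.pow_card_pow]
      simp only [p, Polynomial.eval_finsetSum, Polynomial.eval_mul, Polynomial.eval_C,
        Polynomial.eval_pow, Polynomial.eval_X, h1, Finset.mul_sum]
      rw [Finset.sum_comm]
      refine Finset.sum_eq_zero fun l _ => ?_
      have h2 := congrFun hc l
      simp only [mulVec, dotProduct, mooreMatrix, of_apply, Pi.zero_apply] at h2
      rw [← smul_zero (a l), ← h2, Finset.smul_sum]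
      refine Finset.sum_congr rfl fun k _ => ?_
      rw [mul_smul_comm, mul_comm]
    · rw [Fintype.card_fun, Fintype.card_fin]
      -- For `n = 0` the polynomial is an empty sum, and the degree bound `q ^ (n - 1)` has no
      -- meaning.
      rcases n with _ | n
      · simp [p]
      · refine lt_of_le_of_lt ?_ (Nat.pow_lt_pow_right hr n.lt_succ_self)
        refine Polynomial.natDegree_sum_le_of_forall_le _ _ fun k _ => ?_
        refine (Polynomial.natDegree_C_mul_X_pow_le _ _).trans ?_
        exact Nat.pow_le_pow_right hr.le (Nat.lt_succ_iff.mp k.2)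
  ext k
  have := congrArg (fun p => Polynomial.coeff p (Fintype.card F ^ (k : ℕ))) hp
  simpa [p, Polynomial.coeff_C_mul, Polynomial.coeff_X_pow, (Nat.pow_right_injective hr).eq_iff,
    Fin.val_inj] using this

/-- The group element is the transpose of the descended `S`, because `T` acts on column vectors
through its transpose. -/
theorem exists_mem_isometryGroup {m : ℕ} (σ : F →+* F) (σ' : Ω →+* Ω)
    (hσ : ∀ a, algebraMap F Ω (σ a) = σ' (algebraMap F Ω a)) {B : Matrix (Fin n) (Fin n) F}
    (hB : B.det ≠ 0) {S : Matrix (Fin n) (Fin n) Ω} (hS : S.map (conj F Ω) = S)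
    (hiso : Sᵀ * B.map (algebraMap F Ω) * S.map σ' = B.map (algebraMap F Ω))
    {x y : Fin m × Fin n → Ω} (hy : ∀ i, (fun l => y (i, l)) = S *ᵥ fun l => x (i, l)) :
    ∃ T ∈ isometryGroup σ B, ∀ p, y p = ∑ l, algebraMap F Ω (T.val l p.2) * x (p.1, l) := by
  choose f hf using fun i j => mem_range_of_conj_eq (F := F) (congrFun (congrFun hS i) j)
  let T : Matrix (Fin n) (Fin n) F := of fun j i => f i j
  have hST : S = (T.map (algebraMap F Ω))ᵀ := by
    ext i j
    exact (hf i j).symm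
  have hTσ : S.map σ' = ((T.map σ).map (algebraMap F Ω))ᵀ := by
    ext i j
    simp only [hST, map_apply, transpose_apply, hσ]
  have hT : T * B * (T.map σ)ᵀ = B := by
    apply Matrix.map_injective (algebraMap F Ω).injective
    simp only
    rw [Matrix.map_mul, Matrix.map_mul, ← transpose_map]
    rw [hTσ, hST, transpose_transpose] at hiso
    exact hiso
  have hdet : T.det ≠ 0 := by
    intro h
    have := congrArg det hT
    rw [det_mul, det_mul, h, zero_mul, zero_mul] at this
    exact hB this.symm
  refine ⟨GeneralLinearGroup.mkOfDetNeZero T hdet, hT, fun p => ?_⟩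
  have := congrFun (hy p.1) p.2
  refine this.trans ?_
  rw [hST]
  rfl

end Frobenius

/-! ### Invariance of the form polynomials, and derivations killing them -/

section Coordinates

variable {F : Type*} [Field F] {m n : ℕ}

theorem aeval_formPoly {A : Type*} [CommRing A] [Algebra F A] (x : Fin m × Fin n → A)
    (B : Matrix (Fin n) (Fin n) F) (i j : Fin m) (e : ℕ) :
    aeval x (formPoly B i j e) =
      (fun l => x (i, l)) ⬝ᵥ B.map (algebraMap F A) *ᵥ fun l => x (j, l) ^ e := by
  simp [formPoly, coordVec, dotProduct, mulVec]

/-- The `e`-th power map is additive and acts on scalars as `σ`, so the right-hand vector transforms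
by the twisted transpose of `T`. -/
theorem subst_formPoly {σ : F →+* F} {B : Matrix (Fin n) (Fin n) F} {T : GL (Fin n) F}
    (hT : T ∈ isometryGroup σ B) (e : ℕ) (ψ : CoordRing F m n →+* CoordRing F m n)
    (hψ : ∀ f, ψ f = f ^ e) (hσ : ∀ a, σ a = a ^ e) (i j : Fin m) :
    subst m T.val (formPoly B i j e) = formPoly B i j e := by
  have hT' : T.val * B * (T.val.map σ)ᵀ = B := hT
  set c : F →+* CoordRing F m n := algebraMap F (CoordRing F m n) with hc
  have h1 : ∀ i : Fin m, (fun l => ∑ k, C (T.val k l) * X (i, k) : Fin n → CoordRing F m n) =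
      (T.val.map c)ᵀ *ᵥ fun l => X (i, l) := fun i => rfl
  have h2 : (fun l => (∑ k, C (T.val k l) * X (j, k) : CoordRing F m n) ^ e) =
      ((T.val.map σ)ᵀ).map c *ᵥ fun l => X (j, l) ^ e := by
    ext1 l
    rw [← hψ, map_sum]
    refine Finset.sum_congr rfl fun k _ => ?_
    rw [hψ, mul_pow, ← C_pow, ← hσ]
    rfl
  rw [subst, aeval_formPoly]
  simp only
  rw [h1, h2, mulVec_transpose, ← dotProduct_mulVec, mulVec_mulVec, mulVec_mulVec,
    ← Matrix.map_mul, ← Matrix.map_mul, hT']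
  have := aeval_formPoly (X : Fin m × Fin n → CoordRing F m n) B i j e
  rw [aeval_X_left_apply] at this
  exact this.symm

variable {M : Type*} [AddCommGroup M] [Module (RatField F m n) M] [Module F M]
  (D : Derivation F (RatField F m n) M)

theorem toRat_formPoly (B : Matrix (Fin n) (Fin n) F) (i j : Fin m) (e : ℕ) :
    toRat (formPoly B i j e) = ∑ l, toRat (X (i, l)) *
      (B.map (algebraMap F (RatField F m n)) *ᵥ fun l' => toRat (X (j, l')) ^ e) l := by
  have := aeval_formPoly (fun p => toRat (X p) : Fin m × Fin n → RatField F m n) B i j e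
  have h : aeval (fun p => toRat (X p) : Fin m × Fin n → RatField F m n) =
      Algebra.algHom F (CoordRing F m n) (RatField F m n) :=
    MvPolynomial.algHom_ext fun p => by rw [aeval_X]; rfl
  rw [h] at this
  exact this

theorem derivation_mulVec (B : Matrix (Fin n) (Fin n) F) (v : Fin n → RatField F m n) (l : Fin n) :
    D ((B.map (algebraMap F (RatField F m n)) *ᵥ v) l) =
      ∑ l', algebraMap F (RatField F m n) (B l l') • D (v l') := by
  simp only [mulVec, dotProduct, map_sum, Derivation.leibniz, map_apply, D.map_algebraMap,
    smul_zero, add_zero]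

theorem derivation_formPoly {B : Matrix (Fin n) (Fin n) F} {i j : Fin m} {e : ℕ}
    (h : ∀ l, D (toRat (X (j, l)) ^ e) = 0) :
    D (toRat (formPoly B i j e)) = ∑ l,
      (B.map (algebraMap F (RatField F m n)) *ᵥ fun l' => toRat (X (j, l')) ^ e) l •
        D (toRat (X (i, l))) := by
  rw [toRat_formPoly, map_sum]
  refine Finset.sum_congr rfl fun l _ => ?_
  rw [Derivation.leibniz, derivation_mulVec]
  simp [h]

/-- With exponent one, both arguments contribute, equally by symmetry; hence the factor two. -/
theorem derivation_formPoly_self {A : Matrix (Fin n) (Fin n) F} (hA : Aᵀ = A) (i : Fin m) :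
    D (toRat (formPoly A i i 1)) = (2 : RatField F m n) • ∑ l,
      (A.map (algebraMap F (RatField F m n)) *ᵥ fun l' => toRat (X (i, l')) ^ 1) l •
        D (toRat (X (i, l))) := by
  rw [toRat_formPoly, map_sum, two_smul]
  simp only [Derivation.leibniz, derivation_mulVec, Finset.sum_add_distrib, pow_one]
  rw [add_comm, add_right_inj]
  simp only [Finset.smul_sum, mulVec, dotProduct, Finset.sum_smul]
  rw [Finset.sum_comm]
  refine Finset.sum_congr rfl fun k _ => Finset.sum_congr rfl fun l _ => ?_
  have : A l k = A k l := congrFun (congrFun hA k) l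
  rw [smul_smul, map_apply, this, mul_comm]

theorem eq_zero_of_sum_smul_eq_zero {R V : Type*} [Field R] [AddCommGroup V] [Module R V]
    {G : Matrix (Fin n) (Fin n) R} (hG : G.det ≠ 0) {v : Fin n → V}
    (h : ∀ k, ∑ l, G l k • v l = 0) : v = 0 := by
  ext j
  have hGG : G * G⁻¹ = 1 := mul_nonsing_inv _ hG.isUnit
  have h1 : ∑ k, G⁻¹ k j • ∑ l, G l k • v l = 0 := by simp [h]
  have h2 : ∑ k, G⁻¹ k j • ∑ l, G l k • v l = ∑ l, (G * G⁻¹) l j • v l := by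
    simp only [Finset.smul_sum, mul_apply, Finset.sum_smul, smul_smul]
    rw [Finset.sum_comm]
    refine Finset.sum_congr rfl fun k _ => Finset.sum_congr rfl fun l _ => ?_
    rw [mul_comm]
  rw [h2, hGG] at h1
  simpa [Matrix.one_apply, ite_smul] using h1

/-- The hypotheses are a square linear system in the `D x_{il}` with invertible matrix `B * N`,
where `N` collects the powers of `X_j`. -/
theorem derivation_coord_eq_zero {B : Matrix (Fin n) (Fin n) F} (hB : B.det ≠ 0) {i j : Fin m}
    {N : Matrix (Fin n) (Fin n) (RatField F m n)} (hN : N.det ≠ 0) (e : Fin n → ℕ)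
    (hNe : ∀ l k, N l k = toRat (X (j, l)) ^ e k)
    (h : ∀ k, ∑ l,
      (B.map (algebraMap F (RatField F m n)) *ᵥ fun l' => toRat (X (j, l')) ^ e k) l •
        D (toRat (X (i, l))) = 0) (l : Fin n) : D (toRat (X (i, l))) = 0 := by
  have hdet : (B.map (algebraMap F (RatField F m n)) * N).det ≠ 0 := by
    rw [det_mul, ← RingHom.mapMatrix_apply, ← RingHom.map_det]
    exact mul_ne_zero (by simpa using hB) hN
  refine congrFun (eq_zero_of_sum_smul_eq_zero hdet (v := fun l => D (toRat (X (i, l)))) ?_) l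
  intro k
  rw [← h k]
  refine Finset.sum_congr rfl fun l _ => ?_
  congr 1
  simp only [mul_apply, hNe, mulVec, dotProduct]

theorem linearIndependent_coord {A : Type*} [CommRing A] [Algebra F A] {x : Fin m × Fin n → A}
    (hx : AlgebraicIndependent F x) (i : Fin m) : LinearIndependent F fun l => x (i, l) :=
  hx.linearIndependent.comp (fun l => (i, l)) fun _ _ h => (Prod.mk.inj h).2

theorem linearIndependent_toRat_X (i : Fin m) :
    LinearIndependent F fun l => (toRat (X (i, l)) : RatField F m n) :=
  linearIndependent_coord (x := fun p => toRat (X p))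
    ((MvPolynomial.algebraicIndependent_X (Fin m × Fin n) F).map'
      (f := Algebra.algHom F (CoordRing F m n) (RatField F m n)) (IsFractionRing.injective _ _)) i

theorem derivation_pow_card_pow (K : Type*) [Field K] [Fintype K] [Algebra K F] {k : ℕ}
    (hk : 1 ≤ k) (a : RatField F m n) : D (a ^ Fintype.card K ^ k) = 0 := by
  have h0 : ((Fintype.card K ^ k : ℕ) : F) = 0 := by
    rw [Nat.cast_pow, ← map_natCast (algebraMap K F), FiniteField.cast_card_eq_zero, map_zero,
      zero_pow (by omega)]
  have h1 : ((Fintype.card K ^ k : ℕ) : RatField F m n) = 0 := by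
    rw [← map_natCast (algebraMap F (RatField F m n)), h0, map_zero]
  rw [D.leibniz_pow, ← Nat.cast_smul_eq_nsmul (RatField F m n), h1, zero_smul]

end Coordinates

/-! ### The three families of groups -/

theorem det_map_algebraMap_ne_zero {F A : Type*} [Field F] [Field A] [Algebra F A] {n : ℕ}
    {B : Matrix (Fin n) (Fin n) F} (hB : B.det ≠ 0) : (B.map (algebraMap F A)).det ≠ 0 := by
  rw [← RingHom.mapMatrix_apply, ← RingHom.map_det]
  simpa using hB

theorem map_algebraMap_conj {F A : Type*} [Field F] [Fintype F] [Field A] [Algebra F A] {n : ℕ}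
    (B : Matrix (Fin n) (Fin n) F) :
    (B.map (algebraMap F A)).map (conj F A) = B.map (algebraMap F A) := by
  ext i j
  exact conj_algebraMap _

/-- The power map `f ↦ f ^ |K| ^ k` as a ring endomorphism of the coordinate ring. -/
noncomputable def coordFrobenius (K : Type*) {F : Type*} [Field K] [Fintype K] [Field F]
    [Algebra K F] (m n k : ℕ) : CoordRing F m n →+* CoordRing F m n :=
  (FiniteField.frobeniusAlgHom K (CoordRing F m n)).toRingHom ^ k

theorem coordFrobenius_apply (K : Type*) {F : Type*} [Field K] [Fintype K] [Field F]
    [Algebra K F] (m n k : ℕ) (f : CoordRing F m n) :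
    coordFrobenius K m n k f = f ^ Fintype.card K ^ k := by
  induction k with
  | zero => simp [coordFrobenius]
  | succ k ih =>
    rw [coordFrobenius, pow_succ', RingHom.mul_def, RingHom.comp_apply]
    change (coordFrobenius K m n k f) ^ Fintype.card K = _
    rw [ih, ← pow_mul, ← pow_succ]

theorem invariantField_symplecticGroup {F : Type*} [Field F] [Fintype F] {m n : ℕ} (i₀ : Fin m)
    {K : Matrix (Fin n) (Fin n) F} (hK : Kᵀ = -K) (hd : ∀ i, K i i = 0) (hdet : K.det ≠ 0) :
    invariantField m (VectorInvariants.symplecticGroup K) = IntermediateField.adjoin F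
      (toRat '' {f | ∃ (i : Fin m) (k : ℕ), 1 ≤ k ∧ k ≤ n ∧ f = sympPoly K i i₀ k}) := by
  refine invariantField_eq_adjoin _ _ ?_ ?_ ?_
  · rintro T hT _ ⟨i, k, -, -, rfl⟩
    exact subst_formPoly hT _ (coordFrobenius F m n k) (coordFrobenius_apply F m n k)
      (fun a => (FiniteField.pow_card_pow k a).symm) _ _
  · intro M _ _ _ D hD p
    -- The exponents start at `q ^ 1`, so the Moore matrix is shifted by one Frobenius.
    refine derivation_coord_eq_zero D hdet (j := i₀)
      (N := (mooreMatrix (conj F _) fun l => toRat (X (i₀, l))).map (conj F _))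
      (det_map_ne_zero _ (det_mooreMatrix_ne_zero (linearIndependent_toRat_X i₀)))
      (fun k => Fintype.card F ^ ((k : ℕ) + 1)) ?_ ?_ p.2
    · intro l k
      rw [← conj_pow_apply, pow_succ']
      rfl
    · intro k
      rw [← derivation_formPoly D fun l => derivation_pow_card_pow D F (by omega) _]
      exact hD _ ⟨p.1, k + 1, by omega, by omega, rfl⟩
  · intro Ω _ _ x y hx hxy
    obtain ⟨S, hS, hiso, hy⟩ := exists_symplectic_of_form_eq (φ := conj F Ω)
      (K := K.map (algebraMap F Ω)) (x := fun i l => x (i, l)) (y := fun i l => y (i, l))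
      (by rw [← transpose_map, hK]; ext; simp) (by simp [hd])
      (det_map_algebraMap_ne_zero hdet) (map_algebraMap_conj K) i₀
      (det_mooreMatrix_ne_zero (linearIndependent_coord hx i₀)) (by
        intro i k hk hkn
        have := hxy _ ⟨i, k, hk, hkn, rfl⟩
        rw [sympPoly, aeval_formPoly, aeval_formPoly] at this
        simp only [← conj_pow_apply (F := F)] at this
        exact this)
    exact exists_mem_isometryGroup (RingHom.id F) (RingHom.id Ω) (fun _ => rfl) hdet hS
      (by simpa [Matrix.map_id'] using! hiso) hy

theorem invariantField_orthogonalGroup {F : Type*} [Field F] [Fintype F] {m n : ℕ} (i₀ : Fin m)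
    {A : Matrix (Fin n) (Fin n) F} (h2 : ringChar F ≠ 2) (hA : Aᵀ = A) (hdet : A.det ≠ 0) :
    invariantField m (VectorInvariants.orthogonalGroup A) = IntermediateField.adjoin F
      (toRat '' {f | ∃ (i : Fin m) (k : ℕ), k < n ∧ f = orthPoly A i i₀ k}) := by
  have h2F : (2 : F) ≠ 0 := Ring.two_ne_zero h2
  have h2' : ∀ (R : Type _) [Field R] [Algebra F R], (2 : R) ≠ 0 := by
    intro R _ _ h
    apply h2F
    apply (algebraMap F R).injective
    rw [map_ofNat, h, map_zero]
  refine invariantField_eq_adjoin _ _ ?_ ?_ ?_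
  · rintro T hT _ ⟨i, k, -, rfl⟩
    exact subst_formPoly hT _ (coordFrobenius F m n k) (coordFrobenius_apply F m n k)
      (fun a => (FiniteField.pow_card_pow k a).symm) _ _
  · intro M _ _ _ D hD p
    have step : ∀ i : Fin m, (∑ l, (A.map (algebraMap F (RatField F m n)) *ᵥ
          fun l' => toRat (X (i₀, l')) ^ 1) l • D (toRat (X (i, l))) = 0) →
        ∀ l, D (toRat (X (i, l))) = 0 := by
      intro i hi
      refine derivation_coord_eq_zero D hdet (j := i₀)
        (N := mooreMatrix (conj F _) fun l => toRat (X (i₀, l)))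
        (det_mooreMatrix_ne_zero (linearIndependent_toRat_X i₀))
        (fun k => Fintype.card F ^ (k : ℕ)) ?_ ?_
      · intro l k
        rw [← conj_pow_apply]
        rfl
      · intro k
        rcases Nat.eq_zero_or_pos (k : ℕ) with hk | hk
        · rw [hk, pow_zero]
          exact hi
        · rw [← derivation_formPoly D fun l => derivation_pow_card_pow D F hk _]
          exact hD _ ⟨i, k, k.2, rfl⟩
    -- The index `p` itself shows that `n` is positive, so the generator with `k = 0` is present.
    have hn : 0 < n := p.2.pos
    have horth : ∀ i, D (toRat (formPoly A i i₀ 1)) = 0 := fun i => by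
      rw [← pow_zero (Fintype.card F)]
      exact hD _ ⟨i, 0, hn, rfl⟩
    -- The vector `X_1` comes first, through the quadratic generator and division by two; afterwards
    -- its coordinates are constants in the generator with `k = 0` for every other `i`.
    have h0 : ∀ l, D (toRat (X (i₀, l))) = 0 := by
      refine step i₀ ?_
      have := derivation_formPoly_self D hA i₀
      rw [horth i₀, eq_comm, smul_eq_zero] at this
      exact this.resolve_left (h2' _)
    refine step p.1 ?_ p.2
    rw [← derivation_formPoly D fun l => by rw [pow_one]; exact h0 l]
    exact horth p.1
  · intro Ω _ _ x y hx hxy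
    obtain ⟨S, hS, hiso, hy⟩ := exists_orthogonal_of_form_eq (φ := conj F Ω)
      (A := A.map (algebraMap F Ω)) (x := fun i l => x (i, l)) (y := fun i l => y (i, l))
      (h2' Ω) (by rw [← transpose_map, hA])
      (det_map_algebraMap_ne_zero hdet) (map_algebraMap_conj A) i₀
      (det_mooreMatrix_ne_zero (linearIndependent_coord hx i₀)) (by
        intro i k hkn
        have := hxy _ ⟨i, k, hkn, rfl⟩
        rw [orthPoly, aeval_formPoly, aeval_formPoly] at this
        simp only [← conj_pow_apply (F := F)] at this
        exact this)
    exact exists_mem_isometryGroup (RingHom.id F) (RingHom.id Ω) (fun _ => rfl) hdet hS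
      (by simpa [Matrix.map_id'] using! hiso) hy

theorem conj_pow_two {F E : Type*} [Field F] [Fintype F] [Field E] [Fintype E] [Algebra F E]
    (h : Module.finrank F E = 2) (Ω : Type*) [Field Ω] [Algebra F Ω] [Algebra E Ω] :
    conj F Ω ^ 2 = conj E Ω := by
  ext a
  rw [conj_pow_apply, conj_apply, Module.card_eq_pow_finrank (K := F) (V := E), h]

theorem invariantField_unitaryGroup {F E : Type*} [Field F] [Fintype F] [Field E] [Algebra F E]
    {m n : ℕ} (i₀ : Fin m) {H : Matrix (Fin n) (Fin n) E} (hFE : Module.finrank F E = 2)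
    (hH : (H.map (conj F E))ᵀ = H) (hdet : H.det ≠ 0) :
    invariantField m (VectorInvariants.unitaryGroup F H) = IntermediateField.adjoin E
      (toRat '' {f | ∃ (i : Fin m) (k : ℕ), k < n ∧ f = unitPoly F H i i₀ k}) := by
  have hfin : Module.Finite F E := Module.finite_of_finrank_pos (by omega)
  have : Finite E := Module.finite_of_finite F
  let _ : Fintype E := Fintype.ofFinite E
  refine invariantField_eq_adjoin _ _ ?_ ?_ ?_
  · rintro T hT _ ⟨i, k, -, rfl⟩
    refine subst_formPoly hT _ (coordFrobenius F m n (2 * k + 1))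
      (coordFrobenius_apply F m n (2 * k + 1)) (fun a => ?_) _ _
    rw [pow_succ, pow_mul, pow_mul, ← hFE, ← Module.card_eq_pow_finrank (K := F) (V := E),
      FiniteField.pow_card_pow, conj_apply]
  · intro M _ _ _ D hD p
    refine derivation_coord_eq_zero D hdet (j := i₀)
      -- Exponents `q ^ (2k + 1)` are the powers of the Frobenius of `E` followed by one
      -- conjugation.
      (N := (mooreMatrix (conj E _) fun l => toRat (X (i₀, l))).map (conj F _))
      (det_map_ne_zero _ (det_mooreMatrix_ne_zero (linearIndependent_toRat_X i₀)))
      (fun k => Fintype.card F ^ (2 * (k : ℕ) + 1)) ?_ ?_ p.2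
    · intro l k
      rw [← conj_pow_apply, pow_succ', pow_mul, conj_pow_two hFE]
      rfl
    · intro k
      rw [← derivation_formPoly D fun l => derivation_pow_card_pow D F (by omega) _]
      exact hD _ ⟨p.1, k, by omega, rfl⟩
  · intro Ω _ _ x y hx hxy
    -- The conjugation on `Ω` needs an `F`-structure, taken through `E`.
    let _ : Algebra F Ω := ((algebraMap E Ω).comp (algebraMap F E)).toAlgebra
    have hmoore := det_mooreMatrix_ne_zero (linearIndependent_coord hx i₀)
    rw [← conj_pow_two hFE] at hmoore
    have hc : ∀ a, algebraMap E Ω (conj F E a) = conj F Ω (algebraMap E Ω a) := by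
      intro a
      rw [conj_apply, conj_apply, map_pow]
    obtain ⟨S, hS, hiso, hy⟩ := exists_unitary_of_form_eq (τ := conj F Ω)
      (H := H.map (algebraMap E Ω)) (x := fun i l => x (i, l)) (y := fun i l => y (i, l))
      (by
        conv_rhs => rw [← hH]
        ext i j
        simp [hc])
      (det_map_algebraMap_ne_zero hdet) i₀ hmoore (by
        intro i k hkn
        have := hxy _ ⟨i, k, hkn, rfl⟩
        rw [unitPoly, aeval_formPoly, aeval_formPoly] at this
        simp only [← conj_pow_apply (F := F)] at this
        exact this)
    rw [conj_pow_two hFE] at hS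
    exact exists_mem_isometryGroup (conj F E) (conj F Ω) hc hdet hS hiso hy

end VectorInvariants

open VectorInvariants in
theorem theorem4p1 (m : ℕ) (hm : 1 ≤ m) :
    -- symplectic groups, over any finite field
    (∀ (F : Type*) [Field F] [Fintype F] (n : ℕ) (K : Matrix (Fin (2 * n)) (Fin (2 * n)) F),
      K.transpose = -K → (∀ i, K i i = 0) → K.det ≠ 0 →
        invariantField m (VectorInvariants.symplecticGroup K) =
          IntermediateField.adjoin F
            {f | ∃ (i : Fin m) (k : ℕ), 1 ≤ k ∧ k ≤ 2 * n ∧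
              f = toRat (sympPoly K i ⟨0, hm⟩ k)}) ∧
    -- unitary groups, over the quadratic extension `E` of a finite field `F` of odd characteristic
    (∀ (F E : Type*) [Field F] [Fintype F] [Field E] [Algebra F E] (n : ℕ)
      (H : Matrix (Fin n) (Fin n) E),
      ringChar F ≠ 2 → Module.finrank F E = 2 →
      (H.map (conj F E)).transpose = H → H.det ≠ 0 →
        invariantField m (VectorInvariants.unitaryGroup F H) =
          IntermediateField.adjoin E
            {f | ∃ (i : Fin m) (k : ℕ), k < n ∧
              f = toRat (unitPoly F H i ⟨0, hm⟩ k)}) ∧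
    -- orthogonal groups, over a finite field of odd characteristic
    (∀ (F : Type*) [Field F] [Fintype F] (n : ℕ) (A : Matrix (Fin n) (Fin n) F),
      ringChar F ≠ 2 → A.transpose = A → A.det ≠ 0 →
        invariantField m (VectorInvariants.orthogonalGroup A) =
          IntermediateField.adjoin F
            {f | ∃ (i : Fin m) (k : ℕ), k < n ∧
              f = toRat (orthPoly A i ⟨0, hm⟩ k)}) := by
  refine ⟨?_, ?_, ?_⟩
  · intro F _ _ n K hK hd hdet
    rw [invariantField_symplecticGroup ⟨0, hm⟩ hK hd hdet]
    congr 1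
    ext f
    constructor
    · rintro ⟨_, ⟨i, k, h1, hk, rfl⟩, rfl⟩
      exact ⟨i, k, h1, hk, rfl⟩
    · rintro ⟨i, k, h1, hk, rfl⟩
      exact ⟨_, ⟨i, k, h1, hk, rfl⟩, rfl⟩
  · intro F E _ _ _ _ n H _ hFE hH hdet
    rw [invariantField_unitaryGroup ⟨0, hm⟩ hFE hH hdet]
    congr 1
    ext f
    constructor
    · rintro ⟨_, ⟨i, k, hk, rfl⟩, rfl⟩
      exact ⟨i, k, hk, rfl⟩
    · rintro ⟨i, k, hk, rfl⟩
      exact ⟨_, ⟨i, k, hk, rfl⟩, rfl⟩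
  · intro F _ _ n A h2 hA hdet
    rw [invariantField_orthogonalGroup ⟨0, hm⟩ h2 hA hdet]
    congr 1
    ext f
    constructor
    · rintro ⟨_, ⟨i, k, hk, rfl⟩, rfl⟩
      exact ⟨i, k, hk, rfl⟩
    · rintro ⟨i, k, hk, rfl⟩
      exact ⟨_, ⟨i, k, hk, rfl⟩, rfl⟩
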